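/- Let $FA=GF_2\langle a_1,\dots,a_k\rangle$ be the free associative algebra over the field with two elements and let $\deg$ denote the degree. For $u\in FA$, $u\neq 0$, whose top homogeneous part is a monomial, that monomial is called the top monomial of $u$. A monomial (a word in $a_1,\dots,a_k$) has no periodicity if it has no subword of the form $\alpha\alpha$ with $\alpha$ a non-empty word. Let $u_1,u_2,u_3,v_1,v_2,v_3\in FA$ satisfy $u_1\ne v_1$, $\deg u_1=\deg v_1$, $\deg u_2>\deg v_2$, $\deg v_3>\deg u_3$, and suppose that the top homogeneous parts of all the $u_i$ and $v_i$ are monomials with no periodicity. Suppose that the equation $$u_1xu_2xu_3=v_1xv_2xv_3\qquad(*)$$ has a solution $x_1\in FA$ with $\deg x_1>2\,(\deg u_1+\deg u_2+(\deg u_3)^2)$ such that all the periodicity in the top monomial $w$ of the two (equal) sides of $(*)$ at $x=x_1$ is contained in the periodicity of the top monomial $y$ of $x_1$ (the top homogeneous part of $x_1$ is necessarily a monomial here), in the following sense: each occurrence of a subword $\alpha\alpha$ of $w$, with $\alpha$ non-empty, lies inside a subword $z$ of $w$ that contains a copy of $y$ and has a period $p>0$ with $2p\le \deg x_1$ (letters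 of $z$ at distance $p$ are equal). Then there exist $s,t\in FA$ such that one of the following holds: (A) there are $\mu_1,\mu_2,s_2,t_2\in FA$ with $u_1=\mu_1(s+1)$, $v_1=\mu_1 s$, $v_2=(t+1)\mu_2$, $u_2=t\mu_2s_2$, $v_3=t_2u_3$, where $(s_2,t_2)$ is $(s,t)$ or $(s+1,t+1)$; (B) there are $\mu_1,\mu_2,s_2,t_2\in FA$ with $u_1=\mu_1 s$, $v_1=\mu_1(s+1)$, $u_2=(t+1)\mu_2$, $v_2s_2=t\mu_2$, $v_3=t_2u_3$, where $(s_2,t_2)$ is $(s,t)$ or $(s+1,t+1)$; and moreover, for the same $s,t$: every solution $x\in FA$ of $sx=xt$ is a solution of $(*)$, and every solution $x_2$ of $(*)$ with $$\deg x_2>2\,\bigl(2+2^{\deg s+2}+\deg u_1+\deg u_2+\deg u_3\bigr)$$ is a solution of $sx=xt$. -/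

import Mathlib

namespace MonomialEq

/-- The free associative algebra `FA = GF₂⟨a₁, …, a_k⟩`. -/
abbrev FA (k : ℕ) : Type := FreeAlgebra (ZMod 2) (Fin k)

variable {k : ℕ}

/-- The finite set of monomials (words in the generators) that occur in `f`,
that is, those that have coefficient `1`. -/
noncomputable def monomials (f : FA k) : Finset (FreeMonoid (Fin k)) :=
  (FreeAlgebra.equivMonoidAlgebraFreeMonoid f).coeff.support

/-- The degree of `f`: the largest length of a monomial of `f` (and `0` for `f = 0`). -/
noncomputable def deg (f : FA k) : ℕ :=
  (monomials f).sup fun m => m.toList.length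

/-- The top homogeneous part of `f` is the monomial `m`: the word `m` occurs in `f` and every
other word that occurs in `f` is strictly shorter. In particular `f ≠ 0`. -/
def IsTopMonomial (f : FA k) (m : FreeMonoid (Fin k)) : Prop :=
  m ∈ monomials f ∧ ∀ w ∈ monomials f, w ≠ m → w.toList.length < m.toList.length

/-- The word `w` has no (non-trivial) periodicity: it contains no subword `αα` with `α`
non-empty. -/
def NoPeriodicity (w : FreeMonoid (Fin k)) : Prop :=
  ∀ a α b : FreeMonoid (Fin k), w = a * α * α * b → α = 1

/-- The top homogeneous part of `f` is a monomial with no periodicity. -/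
def AperiodicTop (f : FA k) : Prop :=
  ∃ m, IsTopMonomial f m ∧ NoPeriodicity m

/-- `p` is a period of the word `z`: letters of `z` at distance `p` are equal. -/
def HasPeriod (z : FreeMonoid (Fin k)) (p : ℕ) : Prop :=
  ∀ i, i + p < z.toList.length → z.toList[i]? = z.toList[i + p]?

/-- All the periodicity of the word `w` is contained in the periodicity of its subword `y`:
each occurrence `w = a α α b` of a non-empty square in `w` lies inside a subword
`z` of `w` (`w = a' z b'` with `a'` no longer than `a` and `b'` no longer than `b`) that contains
`y` and continues a periodicity of `y`, that is, `z` has a period `p > 0` that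
fits at least twice into `y`. -/
def PeriodicityContainedIn (w y : FreeMonoid (Fin k)) : Prop :=
  ∀ a α b : FreeMonoid (Fin k), w = a * α * α * b → α ≠ 1 →
    ∃ a' z b' : FreeMonoid (Fin k), w = a' * z * b' ∧
      a'.toList.length ≤ a.toList.length ∧ b'.toList.length ≤ b.toList.length ∧
      (∃ c d : FreeMonoid (Fin k), z = c * y * d) ∧
      ∃ p, 0 < p ∧ 2 * p ≤ y.toList.length ∧ HasPeriod z p

end MonomialEq

/-!
Write `y` for a longest word of the solution `x`. Comparing longest words in the equation gives
`U₁ = V₁`, `U₂ = V₂ β` and `V₃ = γ U₃` for the top words of the coefficients, and each longest word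
`q` of `x` has a longest word `p` with `β p = q γ`. Hence all longest words are prefixes of one
power of `β`, so that `y` is the top word, and `β y = y γ`.

With `r = u₁ - v₁` the top word of `v₁` is `R β`, where `R` is the top word of `r`. If `r` did not
divide `v₁`, then some non-empty suffix `θ` of `R` would be a prefix of `y`, and `θ β` would contain
a square. So `v₁ = r s`, and likewise `v₃ = t₂ u₃`. Cancelling `r` and `u₃` leaves
`s x (v₂ x t₂ - u₂ x) = x u₂ x`, where divisibility by `x` is divisibility after all generators
are specialized to one variable, because the remainder of a division by `x` would have a top word
shorter than `y`. This yields `t`, `s₂`, `μ₂` with `s x = x t`, `s₂ x = x t₂`, `u₂ = t μ₂` and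
`v₂ s₂ = (t + 1) μ₂`. As `s` and `s₂` have the same square-free top word `β`, they differ only by
a scalar factor and a constant, and so do `t` and `t₂`.
-/

namespace MonomialEq

open FreeAlgebra Polynomial

section Words

variable {α : Type*} {a b c d p q w y β γ : FreeMonoid α}

lemma exists_eq_mul_of_mul_eq_mul (h : a * b = c * d) (hl : a.length ≤ c.length) :
    ∃ e, c = a * e ∧ b = e * d := by
  obtain ⟨e, he⟩ := List.prefix_of_prefix_length_le (show a.toList <+: (c * d).toList from ⟨b, h⟩)
    ⟨d, rfl⟩ hl
  have hc : c = a * FreeMonoid.ofList e := he.symm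
  exact ⟨FreeMonoid.ofList e, hc, mul_left_cancel (a := a) (by rw [h, hc, mul_assoc])⟩

lemma eq_and_eq_of_mul_eq_mul (h : a * b = c * d) (hl : a.length = c.length) :
    a = c ∧ b = d :=
  List.append_inj h hl

lemma length_star (w : FreeMonoid α) : (star w).length = w.length :=
  List.length_reverse

lemma length_pos_of_ne_one (h : w ≠ 1) : 0 < w.length :=
  Nat.pos_of_ne_zero (FreeMonoid.length_eq_zero.not.2 h)

lemma exists_conjugators_of_mul_eq_mul (h : a * p * c = b * q * d) (hpq : p.length = q.length)
    (hl : b.length ≤ a.length) : ∃ β γ, a = b * β ∧ d = γ * c ∧ β * p = q * γ := by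
  obtain ⟨β, rfl, hβ⟩ := exists_eq_mul_of_mul_eq_mul (a := b) (b := q * d) (d := p * c)
    (by rw [← mul_assoc, ← mul_assoc, h]) hl
  rw [← mul_assoc] at hβ
  obtain ⟨γ, hγ, rfl⟩ := exists_eq_mul_of_mul_eq_mul hβ (by rw [FreeMonoid.length_mul]; lia)
  exact ⟨β, γ, rfl, rfl, hγ⟩

/-- Iterating `β * p = q * γ` inside `S` shows that each `q ∈ S` is a prefix of a power of `β`. -/
lemma eq_of_forall_exists_mul_eq_mul {S : Set (FreeMonoid α)} (hβ : β ≠ 1)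
    (hS : ∀ q ∈ S, ∃ p ∈ S, β * p = q * γ) (hp : p ∈ S) (hq : q ∈ S)
    (hl : p.length = q.length) : p = q := by
  have iterate : ∀ n, ∀ w ∈ S, ∃ z ∈ S, β ^ n * z = w * γ ^ n := by
    intro n
    induction n with
    | zero => exact fun w hw => ⟨w, hw, by simp⟩
    | succ n ih =>
      intro w hw
      obtain ⟨z, hz, hwz⟩ := hS w hw
      obtain ⟨z', hz', hzz'⟩ := ih z hz
      exact ⟨z', hz', by rw [pow_succ', mul_assoc, hzz', ← mul_assoc, hwz, mul_assoc, ← pow_succ']⟩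
  have length_pow : ∀ n, n ≤ (β ^ n).length := by
    intro n
    induction n with
    | zero => simp
    | succ n ih =>
      have := length_pos_of_ne_one hβ
      rw [pow_succ, FreeMonoid.length_mul]
      lia
  have prefix_pow : ∀ w ∈ S, ∃ e, β ^ w.length = w * e := by
    intro w hw
    obtain ⟨z, -, hz⟩ := iterate w.length w hw
    obtain ⟨e, he, -⟩ := exists_eq_mul_of_mul_eq_mul hz.symm (length_pow _)
    exact ⟨e, he⟩
  obtain ⟨e, he⟩ := prefix_pow p hp
  obtain ⟨f, hf⟩ := prefix_pow q hq
  exact (eq_and_eq_of_mul_eq_mul (by rw [← he, ← hf, hl]) hl).1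

lemma mul_comm_of_mul_eq_mul (ha : a * y = y * c) (hb : b * y = y * d)
    (hl : a.length + b.length ≤ y.length) : a * b = b * a := by
  obtain ⟨e, he, -⟩ := exists_eq_mul_of_mul_eq_mul (a := a * b) (b := y) (c := y) (d := c * d)
    (by rw [mul_assoc, hb, ← mul_assoc, ha, mul_assoc]) (by rwa [FreeMonoid.length_mul])
  obtain ⟨f, hf, -⟩ := exists_eq_mul_of_mul_eq_mul (a := b * a) (b := y) (c := y) (d := d * c)
    (by rw [mul_assoc, ha, ← mul_assoc, hb, mul_assoc])
    (by rwa [FreeMonoid.length_mul, add_comm])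
  exact (eq_and_eq_of_mul_eq_mul (he.symm.trans hf)
    (by simp only [FreeMonoid.length_mul, add_comm])).1

/-- Words without non-empty squares; this is `NoPeriodicity` over an arbitrary alphabet. -/
def SquareFree (w : FreeMonoid α) : Prop :=
  ∀ a b c : FreeMonoid α, w = a * b * b * c → b = 1

lemma SquareFree.of_mul_left (h : SquareFree (a * w)) : SquareFree w := by
  rintro b c d rfl
  exact h (a * b) c d (by simp only [mul_assoc])

lemma SquareFree.of_mul_right (h : SquareFree (w * a)) : SquareFree w := by
  rintro b c d rfl
  exact h b c (d * a) (by simp only [mul_assoc])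

protected lemma SquareFree.star (h : SquareFree w) : SquareFree (star w) := by
  intro a b c hw
  refine star_injective ((h (star c) (star b) (star a) ?_).trans (star_one _).symm)
  rw [← star_star w, hw]
  simp only [star_mul, mul_assoc]

lemma not_squareFree_mul_of_mul_eq_mul (hβ : β ≠ 1) (hy : β * y = y * γ) (hp : y = p * q)
    (hp1 : p ≠ 1) : ¬ SquareFree (p * β) := by
  intro hsq
  induction hn : p.length using Nat.strong_induction_on generalizing p q with
  | _ n ih =>
    have hpq : p * (q * γ) = β * y := by rw [hy, hp, mul_assoc]
    rcases le_or_gt p.length β.length with hl | hl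
    · obtain ⟨e, rfl, -⟩ := exists_eq_mul_of_mul_eq_mul hpq hl
      exact hp1 (hsq 1 p e (by simp only [one_mul, mul_assoc]))
    · obtain ⟨e, rfl, hy'⟩ := exists_eq_mul_of_mul_eq_mul hpq.symm hl.le
      have he : e ≠ 1 := by rintro rfl; simp at hl
      refine ih e.length ?_ hy' he (SquareFree.of_mul_left (by rwa [mul_assoc] at hsq)) rfl
      have := length_pos_of_ne_one hβ
      rw [← hn, FreeMonoid.length_mul]
      lia

lemma eq_of_mul_comm_of_squareFree (h : a * b = b * a) (ha : a ≠ 1) (hb : SquareFree b)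
    (hl : a.length ≤ b.length) : a = b := by
  obtain ⟨e, rfl, he⟩ := exists_eq_mul_of_mul_eq_mul h hl
  by_contra hne
  have he1 : e ≠ 1 := by rintro rfl; simp at hne
  exact not_squareFree_mul_of_mul_eq_mul ha he (mul_one e).symm he1 (he ▸ hb)

lemma eq_of_squareFree_of_mul_eq_mul (hβ : β ≠ 1) (hβsq : SquareFree β)
    (hy : β * y = y * γ) (ha : a ≠ 1) (hasq : SquareFree a) (hay : a * (y * c) = y * d)
    (hl : a.length + β.length ≤ y.length) : a = β := by
  obtain ⟨e, he, -⟩ := exists_eq_mul_of_mul_eq_mul (c := a * y) (d := c)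
    (by rw [mul_assoc, hay]) (by rw [FreeMonoid.length_mul]; lia : y.length ≤ _)
  have hcomm := mul_comm_of_mul_eq_mul he hy hl
  rcases le_total a.length β.length with h | h
  · exact eq_of_mul_comm_of_squareFree hcomm ha hβsq h
  · exact (eq_of_mul_comm_of_squareFree hcomm.symm hβ hasq h).symm

end Words

section Coefficients

variable {R α : Type*} [CommSemiring R] {f g : FreeAlgebra R α} {a b w : FreeMonoid α}

/-- The word `w`, as an element of the free algebra. -/
noncomputable def word : FreeMonoid α →* FreeAlgebra R α :=
  FreeMonoid.lift (ι R)

/-- The coefficient of the word `w` in an element of the free algebra. -/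
noncomputable def wordCoeff (w : FreeMonoid α) : FreeAlgebra R α →ₗ[R] R :=
  (basisFreeMonoid R α).coord w

lemma basisFreeMonoid_apply (w : FreeMonoid α) : basisFreeMonoid R α w = word w := by
  change MonoidAlgebra.lift R _ _ word (MonoidAlgebra.single w 1) = word w
  rw [MonoidAlgebra.lift_single, one_smul]

lemma wordCoeff_word_self : wordCoeff w (word w : FreeAlgebra R α) = 1 := by
  rw [wordCoeff, ← basisFreeMonoid_apply, Module.Basis.coord_apply, Module.Basis.repr_self,
    Finsupp.single_eq_same]

lemma wordCoeff_word_of_ne (h : a ≠ b) : wordCoeff a (word b : FreeAlgebra R α) = 0 := by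
  rw [wordCoeff, ← basisFreeMonoid_apply, Module.Basis.coord_apply, Module.Basis.repr_self,
    Finsupp.single_eq_of_ne h]

lemma mem_of_forall_word_mem {S : Submodule R (FreeAlgebra R α)}
    (h : ∀ w, wordCoeff w f ≠ 0 → word w ∈ S) : f ∈ S := by
  rw [← (basisFreeMonoid R α).linearCombination_repr f, Finsupp.linearCombination_apply]
  refine S.sum_mem fun w hw => S.smul_mem _ ?_
  rw [basisFreeMonoid_apply]
  exact h w (Finsupp.mem_support_iff.1 hw)

lemma exists_of_wordCoeff_mul_ne_zero (h : wordCoeff w (f * g) ≠ 0) :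
    ∃ a b, wordCoeff a f ≠ 0 ∧ wordCoeff b g ≠ 0 ∧ w = a * b := by
  classical
  have hw : w ∈ (equivMonoidAlgebraFreeMonoid (f * g)).coeff.support :=
    Finsupp.mem_support_iff.2 h
  rw [map_mul] at hw
  obtain ⟨a, ha, b, hb, rfl⟩ := Finset.mem_mul.1 (MonoidAlgebra.support_coeff_mul_subset _ _ hw)
  exact ⟨a, b, Finsupp.mem_support_iff.1 ha, Finsupp.mem_support_iff.1 hb, rfl⟩

lemma star_word (w : FreeMonoid α) : star (word w : FreeAlgebra R α) = word (star w) := by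
  induction w using FreeMonoid.inductionOn' with
  | one => simp
  | of_mul a w ih =>
    rw [map_mul, star_mul, ih, star_mul, map_mul, word, FreeMonoid.lift_eval_of, star_ι,
      FreeMonoid.star_of, FreeMonoid.lift_eval_of]

lemma wordCoeff_star_star (w : FreeMonoid α) (f : FreeAlgebra R α) :
    wordCoeff (star w) (star f) = wordCoeff w f := by
  let reverse : FreeAlgebra R α →ₗ[R] FreeAlgebra R α :=
    (MulOpposite.opLinearEquiv R).symm.toLinearMap ∘ₗ starHom.toLinearMap
  suffices f ∈ LinearMap.eqLocus (wordCoeff (star w) ∘ₗ reverse) (wordCoeff w) from this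
  refine mem_of_forall_word_mem fun v _ => ?_
  change wordCoeff (star w) (star (word v)) = wordCoeff w (word v)
  rw [star_word]
  obtain rfl | hne := eq_or_ne w v
  · rw [wordCoeff_word_self, wordCoeff_word_self]
  · rw [wordCoeff_word_of_ne hne, wordCoeff_word_of_ne (star_injective.ne hne)]

end Coefficients

section LongestWords

variable {R α : Type*} [CommSemiring R] {f g : FreeAlgebra R α} {a b m w : FreeMonoid α}

/-- `m` is one of the longest words that occur in `f`. -/
def IsLongestWord (f : FreeAlgebra R α) (m : FreeMonoid α) : Prop :=
  wordCoeff m f ≠ 0 ∧ ∀ w, wordCoeff w f ≠ 0 → w.length ≤ m.length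

/-- `m` is the only longest word that occurs in `f`; this is the paper's top monomial. -/
def IsTopWord (f : FreeAlgebra R α) (m : FreeMonoid α) : Prop :=
  IsLongestWord f m ∧ ∀ w, IsLongestWord f w → w = m

lemma IsLongestWord.length_eq (ha : IsLongestWord f a) (hb : IsLongestWord f b) :
    a.length = b.length :=
  le_antisymm (hb.2 a ha.1) (ha.2 b hb.1)

lemma IsLongestWord.ne_zero (h : IsLongestWord f m) : f ≠ 0 := by
  rintro rfl
  exact h.1 (map_zero _)

lemma IsTopWord.ne_zero (h : IsTopWord f m) : f ≠ 0 :=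
  h.1.ne_zero

lemma exists_isLongestWord (hf : f ≠ 0) : ∃ m, IsLongestWord f m := by
  have hne : ((basisFreeMonoid R α).repr f).support.Nonempty := by
    simpa only [Finsupp.support_nonempty_iff, ne_eq, LinearEquiv.map_eq_zero_iff] using hf
  obtain ⟨m, hm, hmax⟩ := Finset.exists_max_image _ FreeMonoid.length hne
  exact ⟨m, Finsupp.mem_support_iff.1 hm, fun w hw => hmax w (Finsupp.mem_support_iff.2 hw)⟩

lemma isTopWord_of_forall (hf : f ≠ 0) (h : ∀ w, IsLongestWord f w → w = m) : IsTopWord f m := by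
  obtain ⟨w, hw⟩ := exists_isLongestWord hf
  exact ⟨h w hw ▸ hw, h⟩

lemma IsTopWord.length_lt (h : IsTopWord f m) (hw : wordCoeff w f ≠ 0) (hne : w ≠ m) :
    w.length < m.length :=
  (h.1.2 w hw).lt_of_ne fun hl => hne (h.2 w ⟨hw, fun v hv => (h.1.2 v hv).trans hl.ge⟩)

lemma isTopWord_word [Nontrivial R] (w : FreeMonoid α) :
    IsTopWord (word w : FreeAlgebra R α) w := by
  have eq_of_ne_zero : ∀ v, wordCoeff v (word w : FreeAlgebra R α) ≠ 0 → v = w := fun v =>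
    not_imp_comm.1 wordCoeff_word_of_ne
  refine ⟨⟨?_, fun v hv => (eq_of_ne_zero v hv ▸ le_rfl)⟩, fun v hv => eq_of_ne_zero v hv.1⟩
  rw [wordCoeff_word_self]
  exact one_ne_zero

protected lemma IsLongestWord.star (h : IsLongestWord f m) : IsLongestWord (star f) (star m) := by
  refine ⟨by rw [wordCoeff_star_star]; exact h.1, fun w hw => ?_⟩
  rw [← star_star w, wordCoeff_star_star] at hw
  simpa only [length_star] using h.2 _ hw

protected lemma IsTopWord.star (h : IsTopWord f m) : IsTopWord (star f) (star m) :=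
  ⟨h.1.star, fun _ hw => eq_star_of_eq_star (h.2 _ (star_star f ▸ hw.star)).symm⟩

lemma wordCoeff_mul_of_forall_length_le
    (hf : ∀ w, wordCoeff w f ≠ 0 → w.length ≤ a.length)
    (hg : ∀ w, wordCoeff w g ≠ 0 → w.length ≤ b.length) :
    wordCoeff (a * b) (f * g) = wordCoeff a f * wordCoeff b g := by
  classical
  change (equivMonoidAlgebraFreeMonoid (f * g)).coeff (a * b) = _
  rw [map_mul equivMonoidAlgebraFreeMonoid, MonoidAlgebra.coeff_mul, Finsupp.sum,
    Finset.sum_eq_single a, Finsupp.sum, Finset.sum_eq_single b]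
  · exact if_pos rfl
  · exact fun d _ hd => if_neg fun h => hd (mul_left_cancel h)
  · intro hb
    rw [if_pos rfl, Finsupp.notMem_support_iff.1 hb, mul_zero]
  · refine fun c hc hca => Finset.sum_eq_zero fun d hd => if_neg fun h => hca ?_
    have hlc := hf c (Finsupp.mem_support_iff.1 hc)
    have hld := hg d (Finsupp.mem_support_iff.1 hd)
    have hl := congrArg FreeMonoid.length h
    rw [FreeMonoid.length_mul, FreeMonoid.length_mul] at hl
    exact (eq_and_eq_of_mul_eq_mul h (by lia)).1
  · intro ha
    exact Finset.sum_eq_zero fun d _ => by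
      simp only [Finsupp.notMem_support_iff.1 ha, zero_mul, ite_self]

variable [NoZeroDivisors R]

lemma IsLongestWord.mul (ha : IsLongestWord f a) (hb : IsLongestWord g b) :
    IsLongestWord (f * g) (a * b) := by
  refine ⟨?_, fun w hw => ?_⟩
  · rw [wordCoeff_mul_of_forall_length_le ha.2 hb.2]
    exact mul_ne_zero ha.1 hb.1
  · obtain ⟨c, d, hc, hd, rfl⟩ := exists_of_wordCoeff_mul_ne_zero hw
    simpa only [FreeMonoid.length_mul] using add_le_add (ha.2 c hc) (hb.2 d hd)

lemma IsLongestWord.exists_of_mul (hm : IsLongestWord (f * g) m) :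
    ∃ a b, IsLongestWord f a ∧ IsLongestWord g b ∧ m = a * b := by
  obtain ⟨a, ha⟩ := exists_isLongestWord (left_ne_zero_of_mul hm.ne_zero)
  obtain ⟨b, hb⟩ := exists_isLongestWord (right_ne_zero_of_mul hm.ne_zero)
  obtain ⟨c, d, hc, hd, rfl⟩ := exists_of_wordCoeff_mul_ne_zero hm.1
  have hca := ha.2 c hc
  have hdb := hb.2 d hd
  have hl := hm.length_eq (ha.mul hb)
  rw [FreeMonoid.length_mul, FreeMonoid.length_mul] at hl
  exact ⟨c, d, ⟨hc, fun w hw => (ha.2 w hw).trans (by lia)⟩,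
    ⟨hd, fun w hw => (hb.2 w hw).trans (by lia)⟩, rfl⟩

lemma IsTopWord.mul (hf : IsTopWord f a) (hg : IsTopWord g b) : IsTopWord (f * g) (a * b) := by
  refine ⟨hf.1.mul hg.1, fun w hw => ?_⟩
  obtain ⟨c, d, hc, hd, rfl⟩ := hw.exists_of_mul
  rw [hf.2 c hc, hg.2 d hd]

lemma IsTopWord.of_mul_left (h : IsTopWord (f * g) (a * b)) (hf : IsLongestWord f a) :
    IsTopWord g b :=
  isTopWord_of_forall (right_ne_zero_of_mul h.ne_zero) fun _ hw =>
    mul_left_cancel (h.2 _ (hf.mul hw))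

lemma IsTopWord.of_mul_right (h : IsTopWord (f * g) (a * b)) (hg : IsLongestWord g b) :
    IsTopWord f a :=
  isTopWord_of_forall (left_ne_zero_of_mul h.ne_zero) fun _ hw =>
    mul_right_cancel (h.2 _ (hw.mul hg))

end LongestWords

section Differences

variable {R α : Type*} [CommRing R] {f g : FreeAlgebra R α} {m w : FreeMonoid α}

lemma IsTopWord.length_lt_of_sub (hf : IsTopWord f m) (hg : IsTopWord g m)
    (hfg : wordCoeff m f = wordCoeff m g) (hw : wordCoeff w (f - g) ≠ 0) :
    w.length < m.length := by
  rw [map_sub] at hw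
  have hwm : w ≠ m := by
    rintro rfl
    exact hw (sub_eq_zero.2 hfg)
  by_cases hwf : wordCoeff w f = 0
  · refine hg.length_lt (fun hwg => hw ?_) hwm
    rw [hwf, hwg, sub_zero]
  · exact hf.length_lt hwf hwm

lemma isLongestWord_smul_iff [IsDomain R] {c : R} (hc : c ≠ 0) :
    IsLongestWord (c • f) m ↔ IsLongestWord f m := by
  simp only [IsLongestWord, map_smul, smul_ne_zero_iff_right hc]

lemma IsTopWord.smul [IsDomain R] {c : R} (hc : c ≠ 0) (hf : IsTopWord f m) :
    IsTopWord (c • f) m := by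
  simpa only [IsTopWord, isLongestWord_smul_iff hc] using hf

end Differences

section Specialization

variable {R α : Type*}

/-- The specialization of all generators to one variable. On polynomials it turns one-sided
divisibility into divisibility. -/
noncomputable def specialize [CommSemiring R] : FreeAlgebra R α →ₐ[R] R[X] :=
  lift R fun _ => X

lemma specialize_word [CommSemiring R] (w : FreeMonoid α) :
    specialize (word w : FreeAlgebra R α) = X ^ w.length := by
  induction w using FreeMonoid.inductionOn' with
  | one => simp
  | of_mul a w ih =>
    rw [map_mul, map_mul, ih, FreeMonoid.length_mul, FreeMonoid.length_of, pow_add, pow_one, word,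
      FreeMonoid.lift_eval_of, specialize, lift_ι_apply]

lemma specialize_star [CommSemiring R] (f : FreeAlgebra R α) :
    specialize (star f) = specialize f := by
  induction f using FreeAlgebra.induction with
  | grade0 r => rw [star_algebraMap]
  | grade1 a => rw [star_ι]
  | mul f g hf hg => rw [star_mul, map_mul, map_mul, hf, hg, mul_comm]
  | add f g hf hg => rw [star_add, map_add, map_add, hf, hg]

lemma IsTopWord.degree_specialize [CommRing R] {f : FreeAlgebra R α} {m : FreeMonoid α}
    (h : IsTopWord f m) : (specialize f).degree = m.length := by
  have : Nontrivial R := ⟨_, _, h.1.1⟩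
  set c := wordCoeff m f with hc
  have tail_degree_lt : (specialize (f - c • word m)).degree < m.length := by
    rw [← mem_degreeLT]
    refine mem_of_forall_word_mem (S := (degreeLT R m.length).comap specialize.toLinearMap)
      fun w hw => ?_
    rw [map_sub, map_smul] at hw
    have hwm : w ≠ m := by
      rintro rfl
      exact hw (by rw [wordCoeff_word_self, smul_eq_mul, mul_one, hc, sub_self])
    rw [wordCoeff_word_of_ne hwm, smul_zero, sub_zero] at hw
    rw [Submodule.mem_comap, AlgHom.toLinearMap_apply, specialize_word, mem_degreeLT, degree_X_pow]
    exact_mod_cast h.length_lt hw hwm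
  have top_degree : (specialize (c • word m : FreeAlgebra R α)).degree = m.length := by
    rw [map_smul, specialize_word, smul_eq_C_mul, degree_C_mul_X_pow _ h.1.1]
  rw [← add_sub_cancel (c • word m) f, map_add,
    degree_add_eq_left_of_degree_lt (tail_degree_lt.trans_eq top_degree.symm), top_degree]

end Specialization

section Division

variable {K α : Type*} [Field K] {f g h r x : FreeAlgebra K α} {a y : FreeMonoid α}

lemma IsTopWord.exists_eq_mul_add (hr : IsTopWord r a) (f : FreeAlgebra K α) :
    ∃ q ρ, f = r * q + ρ ∧ ∀ w, wordCoeff (a * w) ρ = 0 := by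
  let S : Submodule K (FreeAlgebra K α) :=
    LinearMap.range (LinearMap.mulLeft K r) ⊔ ⨅ w, LinearMap.ker (wordCoeff (a * w))
  suffices hS : ∀ n, ∀ m : FreeMonoid α, m.length = n → word m ∈ S by
    obtain ⟨_, ⟨q, rfl⟩, ρ, hρ, rfl⟩ := Submodule.mem_sup.1
      (mem_of_forall_word_mem (f := f) fun w _ => hS _ w rfl)
    exact ⟨q, ρ, rfl, by simpa only [Submodule.mem_iInf, LinearMap.mem_ker] using hρ⟩
  intro n
  induction n using Nat.strong_induction_on with
  | _ n ih =>
    rintro m rfl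
    by_cases hm : ∃ v, m = a * v
    · obtain ⟨v, rfl⟩ := hm
      have htop := hr.mul (isTopWord_word (R := K) v)
      set c := wordCoeff (a * v) (r * word v)
      have hdiff : word (a * v) - c⁻¹ • (r * word v) ∈ S :=
        mem_of_forall_word_mem fun w hw => ih _
          ((isTopWord_word _).length_lt_of_sub (htop.smul (inv_ne_zero htop.1.1))
            (by rw [map_smul, wordCoeff_word_self, smul_eq_mul, inv_mul_cancel₀ htop.1.1]) hw)
          w rfl
      rw [← sub_add_cancel (word (a * v)) (c⁻¹ • (r * word v))]
      exact S.add_mem hdiff (Submodule.mem_sup_left ⟨c⁻¹ • word v, mul_smul_comm _ _ _⟩)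
    · refine Submodule.mem_sup_right (Submodule.mem_iInf _ |>.2 fun w => ?_)
      exact wordCoeff_word_of_ne fun hw => hm ⟨w, hw.symm⟩

/-- If `f` is not left divisible by `r`, the remainder `ρ` of its division satisfies
`ρ * g ∈ r * FA`, and comparing top words in this relation gives the overlap `θ`. -/
lemma IsTopWord.dvd_or_exists_remainder (hr : IsTopWord r a) (hfg : f * g = r * h) :
    r ∣ f ∨ ∃ q ρ, f = r * q + ρ ∧ ρ ≠ 0 ∧ ∀ w c, IsLongestWord ρ w → IsLongestWord g c →
      ∃ θ d, θ ≠ 1 ∧ a = w * θ ∧ c = θ * d := by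
  obtain ⟨q, ρ, rfl, hρ⟩ := hr.exists_eq_mul_add f
  obtain rfl | hρ0 := eq_or_ne ρ 0
  · exact Or.inl ⟨q, add_zero _⟩
  refine Or.inr ⟨q, ρ, rfl, hρ0, fun w c hw hc => ?_⟩
  have hmul : ρ * g = r * (h - q * g) := by
    rw [mul_sub, ← hfg]
    noncomm_ring
  obtain ⟨a', d, ha', -, hwc⟩ := (hmul ▸ hw.mul hc).exists_of_mul
  obtain rfl := hr.2 a' ha'
  rcases le_or_gt a'.length w.length with hl | hl
  · obtain ⟨e, rfl, -⟩ := exists_eq_mul_of_mul_eq_mul hwc.symm hl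
    exact absurd (hρ e) hw.1
  · obtain ⟨θ, rfl, hc⟩ := exists_eq_mul_of_mul_eq_mul hwc hl.le
    refine ⟨θ, d, ?_, rfl, hc⟩
    rintro rfl
    simp at hl

lemma IsTopWord.dvd_of_mul_eq_mul (hx : IsTopWord x y) (hg : g ≠ 0) (hfg : f * g = x * h)
    (hdvd : specialize x ∣ specialize f) : x ∣ f := by
  obtain hxf | ⟨q, ρ, rfl, hρ0, hρ⟩ := hx.dvd_or_exists_remainder hfg
  · exact hxf
  exfalso
  obtain ⟨c, hc⟩ := exists_isLongestWord hg
  obtain ⟨w, hw⟩ := exists_isLongestWord hρ0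
  obtain ⟨θ, -, hθ, rfl, -⟩ := hρ w c hw hc
  have hρtop : IsTopWord ρ w := ⟨hw, fun w' hw' => by
    obtain ⟨θ', -, -, he, -⟩ := hρ w' c hw' hc
    exact (eq_and_eq_of_mul_eq_mul he.symm (hw'.length_eq hw)).1⟩
  have hdvdρ : specialize x ∣ specialize ρ := by
    rwa [map_add, map_mul, dvd_add_right (dvd_mul_right _ _)] at hdvd
  have hle := degree_le_of_dvd hdvdρ fun h0 => by
    simpa only [h0, degree_zero, WithBot.bot_ne_natCast] using hρtop.degree_specialize
  rw [hx.degree_specialize, hρtop.degree_specialize, Nat.cast_le, FreeMonoid.length_mul] at hle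
  have := length_pos_of_ne_one hθ
  lia

lemma IsTopWord.exists_eq_mul_right_of_mul_eq_mul (hx : IsTopWord x y) (hg : g ≠ 0)
    (hgf : g * f = h * x) (hdvd : specialize x ∣ specialize f) : ∃ q, f = q * x := by
  obtain ⟨q, hq⟩ := hx.star.dvd_of_mul_eq_mul (f := star f) (h := star h) (star_ne_zero.2 hg)
    (by rw [← star_mul, hgf, star_mul]) (by rwa [specialize_star, specialize_star])
  exact ⟨star q, star_injective (by rw [hq, star_mul, star_star])⟩

end Division

section Overlaps

variable {R α : Type*} [CommSemiring R] {f r s t v x C D : FreeAlgebra R α}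
  {a y β γ V : FreeMonoid α}

lemma mem_bot_iff : f ∈ (⊥ : Subalgebra R (FreeAlgebra R α)) ↔ ∀ w, wordCoeff w f ≠ 0 → w = 1 := by
  refine ⟨fun hf w hw => ?_, fun h => ?_⟩
  · obtain ⟨c, rfl⟩ := Algebra.mem_bot.1 hf
    by_contra hw1
    rw [Algebra.algebraMap_eq_smul_one, map_smul, ← map_one word, wordCoeff_word_of_ne hw1,
      smul_zero] at hw
    exact hw rfl
  · refine mem_of_forall_word_mem (S := Subalgebra.toSubmodule ⊥) fun w hw => ?_
    rw [h w hw, map_one]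
    exact one_mem (⊥ : Subalgebra R (FreeAlgebra R α))

variable [NoZeroDivisors R]

lemma exists_mul_eq_mul_of_mul_eq_mul (hx : IsTopWord x y) (hs : IsLongestWord s a)
    (h : s * x = x * t) : ∃ b, a * y = y * b := by
  obtain ⟨y', b, hy', -, hb⟩ := (h ▸ hs.mul hx.1).exists_of_mul
  exact ⟨b, by rw [hb, hx.2 y' hy']⟩

lemma exists_isTopWord_of_mul_eq_mul (hv : IsTopWord v V) (hx : IsTopWord x y)
    (hβ : β ≠ 1) (hβsq : SquareFree β) (hy : β * y = y * γ) (hVsq : SquareFree V)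
    (hl : V.length + β.length ≤ y.length) (hr : r ≠ 0)
    (hrV : ∀ w, wordCoeff w r ≠ 0 → w.length < V.length) (hD : D ≠ 0)
    (hCD : v * (x * C) = r * (x * D)) : ∃ W, V = W * β ∧ IsTopWord r W := by
  obtain ⟨d, hd⟩ := exists_isLongestWord hD
  have eq_mul : ∀ W, IsLongestWord r W → V = W * β := by
    intro W hW
    obtain ⟨V', w, hV', hw, hVw⟩ := (hCD ▸ hW.mul (hx.1.mul hd)).exists_of_mul
    obtain ⟨y', c, hy', -, rfl⟩ := hw.exists_of_mul
    obtain rfl := hv.2 V' hV'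
    obtain rfl := hx.2 y' hy'
    have hlt := hrV W hW.1
    obtain ⟨σ, rfl, hσy⟩ := exists_eq_mul_of_mul_eq_mul hVw hlt.le
    have hσ : σ ≠ 1 := by
      rintro rfl
      simp at hlt
    rw [FreeMonoid.length_mul] at hl
    rw [eq_of_squareFree_of_mul_eq_mul hβ hβsq hy hσ hVsq.of_mul_left hσy.symm (by lia)]
  obtain ⟨W, hW⟩ := exists_isLongestWord hr
  refine ⟨W, eq_mul W hW, hW, fun w hw => ?_⟩
  exact mul_right_cancel ((eq_mul w hw).symm.trans (eq_mul W hW))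

end Overlaps

section Periodicity

variable {K α : Type*} [Field K] {f g h r s s' t t' x : FreeAlgebra K α}
  {a y β γ : FreeMonoid α}

lemma IsTopWord.dvd_of_squareFree (hr : IsTopWord r a) (hx : IsTopWord x y) (hβ : β ≠ 1)
    (hy : β * y = y * γ) (hsq : SquareFree (a * β)) (hl : a.length ≤ y.length) (hg : g ≠ 0)
    (hfg : f * (x * g) = r * h) : r ∣ f := by
  obtain hrf | ⟨q, ρ, -, hρ0, hρ⟩ := hr.dvd_or_exists_remainder hfg
  · exact hrf
  exfalso
  obtain ⟨c, hc⟩ := exists_isLongestWord hg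
  obtain ⟨w, hw⟩ := exists_isLongestWord hρ0
  obtain ⟨θ, d, hθ, rfl, hd⟩ := hρ w _ hw (hx.1.mul hc)
  obtain ⟨e, he, -⟩ := exists_eq_mul_of_mul_eq_mul hd.symm
    (le_trans (by rw [FreeMonoid.length_mul]; lia) hl)
  exact not_squareFree_mul_of_mul_eq_mul hβ hy he hθ (.of_mul_left (a := w) (mul_assoc w θ β ▸ hsq))

lemma IsTopWord.exists_eq_mul_right_of_squareFree (hr : IsTopWord r a) (hx : IsTopWord x y)
    (hγ : γ ≠ 1) (hy : β * y = y * γ) (hsq : SquareFree (γ * a)) (hl : a.length ≤ y.length)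
    (hg : g ≠ 0) (hgf : g * x * f = h * r) : ∃ q, f = q * r := by
  obtain ⟨q, hq⟩ := hr.star.dvd_of_squareFree (f := star f) (g := star g) (h := star h)
    (β := star γ) (γ := star β) hx.star (fun h1 => hγ (star_injective (h1.trans (star_one _).symm)))
    (by rw [← star_mul, ← star_mul, hy]) (by rw [← star_mul]; exact hsq.star)
    (by rwa [length_star, length_star]) (star_ne_zero.2 hg)
    (by rw [← star_mul, ← star_mul, hgf, star_mul])
  exact ⟨star q, star_injective (by rw [hq, star_mul, star_star])⟩

lemma exists_eq_smul_add_algebraMap (hx : IsTopWord x y) (hs : IsTopWord s β)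
    (hs' : IsTopWord s' β) (hsq : SquareFree β) (hl : 2 * β.length ≤ y.length)
    (h : s * x = x * t) (h' : s' * x = x * t') :
    ∃ c : K, c ≠ 0 ∧ ∃ d, s' = c • s + algebraMap K _ d ∧ t' = c • t + algebraMap K _ d := by
  obtain ⟨γ, hy⟩ := exists_mul_eq_mul_of_mul_eq_mul hx hs.1 h
  set c := wordCoeff β s' / wordCoeff β s
  have hc0 : c ≠ 0 := div_ne_zero hs'.1.1 hs.1.1
  have hδ : (s' - c • s) * x = x * (t' - c • t) := by
    rw [sub_mul, mul_sub, h', smul_mul_assoc, mul_smul_comm, h]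
  have length_lt : ∀ w, wordCoeff w (s' - c • s) ≠ 0 → w.length < β.length := fun w =>
    hs'.length_lt_of_sub (hs.smul hc0) (by rw [map_smul, smul_eq_mul, div_mul_cancel₀ _ hs.1.1])
  have longest_eq_one : ∀ m, IsLongestWord (s' - c • s) m → m = 1 := by
    intro m hm
    have hlt := length_lt m hm.1
    obtain ⟨b, hb⟩ := exists_mul_eq_mul_of_mul_eq_mul hx hm hδ
    by_contra hm1
    exact hlt.ne (congrArg _ (eq_of_mul_comm_of_squareFree
      (mul_comm_of_mul_eq_mul hb hy (by lia)) hm1 hsq hlt.le))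
  have hbot : s' - c • s ∈ (⊥ : Subalgebra K (FreeAlgebra K α)) := by
    refine mem_bot_iff.2 fun w hw => ?_
    obtain ⟨m, hm⟩ := exists_isLongestWord (f := s' - c • s) fun h0 =>
      hw (by rw [h0, map_zero])
    have := hm.2 w hw
    rw [longest_eq_one m hm] at this
    exact FreeMonoid.length_eq_zero.1 (Nat.le_zero.1 this)
  obtain ⟨d, hd⟩ := Algebra.mem_bot.1 hbot
  refine ⟨c, hc0, d, (eq_add_of_sub_eq' hd.symm), eq_add_of_sub_eq' ?_⟩
  refine mul_left_cancel₀ hx.ne_zero ?_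
  rw [← hδ, ← hd, Algebra.commutes]

end Periodicity

section TopWordOfSolution

variable {R α : Type*} [CommSemiring R] [NoZeroDivisors R]
  {u₁ u₂ u₃ v₁ v₂ v₃ x : FreeAlgebra R α} {U₁ U₂ U₃ V₁ V₂ V₃ : FreeMonoid α}

lemma exists_isLongestWord_of_solution (hu₁ : IsTopWord u₁ U₁) (hu₂ : IsTopWord u₂ U₂)
    (hu₃ : IsTopWord u₃ U₃) (hv₁ : IsTopWord v₁ V₁) (hv₂ : IsTopWord v₂ V₂)
    (hv₃ : IsTopWord v₃ V₃) (h₁ : U₁.length = V₁.length)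
    (heq : u₁ * x * u₂ * x * u₃ = v₁ * x * v₂ * x * v₃) {q : FreeMonoid α}
    (hq : IsLongestWord x q) :
    ∃ p, IsLongestWord x p ∧ U₁ = V₁ ∧ U₂ * p * U₃ = V₂ * q * V₃ := by
  have hw := (((hv₁.1.mul hq).mul hv₂.1).mul hq).mul hv₃.1
  rw [← heq] at hw
  obtain ⟨w₁, U₃', hw₁, hU₃', e⟩ := hw.exists_of_mul
  obtain ⟨w₂, p, hw₂, hp, rfl⟩ := hw₁.exists_of_mul
  obtain ⟨w₃, U₂', hw₃, hU₂', rfl⟩ := hw₂.exists_of_mul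
  obtain ⟨U₁', p', hU₁', hp', rfl⟩ := hw₃.exists_of_mul
  rw [hu₁.2 _ hU₁', hu₂.2 _ hU₂', hu₃.2 _ hU₃'] at e
  simp only [mul_assoc] at e
  obtain ⟨hVU, e⟩ := eq_and_eq_of_mul_eq_mul e h₁.symm
  obtain ⟨-, e⟩ := eq_and_eq_of_mul_eq_mul e (hq.length_eq hp')
  exact ⟨p, hp, hVU.symm, by simpa only [mul_assoc] using e.symm⟩

lemma exists_isTopWord_of_solution (hu₁ : IsTopWord u₁ U₁) (hu₂ : IsTopWord u₂ U₂)
    (hu₃ : IsTopWord u₃ U₃) (hv₁ : IsTopWord v₁ V₁) (hv₂ : IsTopWord v₂ V₂)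
    (hv₃ : IsTopWord v₃ V₃) (h₁ : U₁.length = V₁.length) (h₂ : V₂.length < U₂.length)
    (hx : x ≠ 0) (heq : u₁ * x * u₂ * x * u₃ = v₁ * x * v₂ * x * v₃) :
    ∃ y β γ, IsTopWord x y ∧ β ≠ 1 ∧ β * y = y * γ ∧ U₁ = V₁ ∧ U₂ = V₂ * β ∧ V₃ = γ * U₃ := by
  have exists_longest := fun q => exists_isLongestWord_of_solution (q := q) hu₁ hu₂ hu₃ hv₁
    hv₂ hv₃ h₁ heq
  obtain ⟨y, hy⟩ := exists_isLongestWord hx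
  obtain ⟨p, hp, hUV, e⟩ := exists_longest y hy
  obtain ⟨β, γ, rfl, rfl, -⟩ := exists_conjugators_of_mul_eq_mul e (hp.length_eq hy) h₂.le
  have hβ : β ≠ 1 := by
    rintro rfl
    simp at h₂
  have conj : ∀ q ∈ {w | IsLongestWord x w}, ∃ p ∈ {w | IsLongestWord x w}, β * p = q * γ := by
    intro q hq
    obtain ⟨p, hp, -, e⟩ := exists_longest q hq
    simp only [mul_assoc, mul_right_inj] at e
    simp only [← mul_assoc, mul_left_inj] at e
    exact ⟨p, hp, e⟩
  have htop : IsTopWord x y := ⟨hy, fun w hw =>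
    eq_of_forall_exists_mul_eq_mul hβ conj hw hy (hw.length_eq hy)⟩
  obtain ⟨p, hp, e⟩ := conj y hy
  rw [htop.2 p hp] at e
  exact ⟨y, β, γ, htop, hβ, e, hUV, rfl, rfl⟩

end TopWordOfSolution

section Factorization

variable {R α : Type*} [CommRing R]
  {u₁ u₂ u₃ v₁ v₂ v₃ s t μ₁ μ₂ s₂ t₂ x : FreeAlgebra R α} {β : FreeMonoid α}

/-- A factorization of the coefficients of `u₁ x u₂ x u₃ = v₁ x v₂ x v₃` through a pair `s`, `t`
such that the solutions of `s x = x t` solve this equation. Over the field with two elements the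
last condition says that `(s₂, t₂)` is `(s, t)` or `(s + 1, t + 1)`, and `(s + 1, t + 1)` is the
pair of case (B) of the theorem. -/
structure IsFactorization (u₁ u₂ u₃ v₁ v₂ v₃ s t μ₁ μ₂ s₂ t₂ : FreeAlgebra R α) : Prop where
  u₁_eq : u₁ = μ₁ * (s + 1)
  v₁_eq : v₁ = μ₁ * s
  u₂_eq : u₂ = t * μ₂
  v₂_mul_eq : v₂ * s₂ = (t + 1) * μ₂
  v₃_eq : v₃ = t₂ * u₃
  exists_eq_smul_add : ∃ c : R, c ≠ 0 ∧ ∃ d,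
    s₂ = c • s + algebraMap R _ d ∧ t₂ = c • t + algebraMap R _ d

namespace IsFactorization

lemma exists_mul_eq_add_smul (hF : IsFactorization u₁ u₂ u₃ v₁ v₂ v₃ s t μ₁ μ₂ s₂ t₂)
    (x : FreeAlgebra R α) : ∃ c : R, c ≠ 0 ∧ x * t₂ = s₂ * x + c • (x * t - s * x) := by
  obtain ⟨c, hc, d, rfl, rfl⟩ := hF.exists_eq_smul_add
  refine ⟨c, hc, ?_⟩
  rw [mul_add, add_mul, ← Algebra.commutes, mul_smul_comm, smul_mul_assoc, smul_sub]
  abel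

lemma solution_of_mul_eq_mul (hF : IsFactorization u₁ u₂ u₃ v₁ v₂ v₃ s t μ₁ μ₂ s₂ t₂)
    (h : s * x = x * t) : u₁ * x * u₂ * x * u₃ = v₁ * x * v₂ * x * v₃ := by
  have h₂ : x * t₂ = s₂ * x := by
    obtain ⟨c, -, hc⟩ := hF.exists_mul_eq_add_smul x
    rw [hc, h, sub_self, smul_zero, add_zero]
  calc u₁ * x * u₂ * x * u₃
      = μ₁ * (s * x + x) * (t * μ₂) * x * u₃ := by rw [hF.u₁_eq, hF.u₂_eq]; noncomm_ring
    _ = μ₁ * (x * t) * ((t + 1) * μ₂) * x * u₃ := by rw [h]; noncomm_ring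
    _ = μ₁ * (s * x) * v₂ * (s₂ * x) * u₃ := by rw [← hF.v₂_mul_eq, ← h]; noncomm_ring
    _ = v₁ * x * v₂ * x * v₃ := by rw [← h₂, hF.v₁_eq, hF.v₃_eq]; noncomm_ring

variable [IsDomain R]

lemma exists_defect_mul_eq (hF : IsFactorization u₁ u₂ u₃ v₁ v₂ v₃ s t μ₁ μ₂ s₂ t₂)
    (hu₁ : u₁ ≠ 0) (hu₃ : u₃ ≠ 0) (heq : u₁ * x * u₂ * x * u₃ = v₁ * x * v₂ * x * v₃) :
    ∃ c : R, c ≠ 0 ∧ (x * t - s * x) * μ₂ * x = c • s * x * v₂ * (x * t - s * x) := by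
  obtain ⟨c, hc, hc'⟩ := hF.exists_mul_eq_add_smul x
  have reduced : (s + 1) * x * u₂ * x = s * x * v₂ * (x * t₂) := by
    refine mul_right_cancel₀ hu₃ (mul_left_cancel₀ (left_ne_zero_of_mul (hF.u₁_eq ▸ hu₁)) ?_)
    rw [hF.u₁_eq, hF.v₁_eq, hF.v₃_eq] at heq
    simpa only [mul_assoc] using heq
  refine ⟨c, hc, ?_⟩
  calc (x * t - s * x) * μ₂ * x
      = (s + 1) * x * (t * μ₂) * x - s * x * ((t + 1) * μ₂) * x := by noncomm_ring
    _ = s * x * v₂ * (x * t₂) - s * x * (v₂ * s₂) * x := by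
      rw [← hF.u₂_eq, reduced, ← hF.v₂_mul_eq]
    _ = s * x * v₂ * (x * t₂ - s₂ * x) := by noncomm_ring
    _ = c • s * x * v₂ * (x * t - s * x) := by
      rw [hc', add_sub_cancel_left, mul_smul_comm]
      simp only [smul_mul_assoc]

/-- If `z := x t - s x` were non-zero, comparing lengths in `z μ₂ x = c s x v₂ z` and in
`v₂ s₂ = (t + 1) μ₂` would force `t` to be constant. -/
lemma mul_eq_mul_of_solution (hF : IsFactorization u₁ u₂ u₃ v₁ v₂ v₃ s t μ₁ μ₂ s₂ t₂)
    (hs : IsLongestWord s β) (hs₂ : IsLongestWord s₂ β) (ht : t ∉ (⊥ : Subalgebra R _))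
    (hu₁ : u₁ ≠ 0) (hu₂ : u₂ ≠ 0) (hu₃ : u₃ ≠ 0)
    (heq : u₁ * x * u₂ * x * u₃ = v₁ * x * v₂ * x * v₃) : s * x = x * t := by
  by_contra hne
  have hz : x * t - s * x ≠ 0 := sub_ne_zero.2 (Ne.symm hne)
  have hx : x ≠ 0 := by
    rintro rfl
    simp at hne
  have hμ₂ : μ₂ ≠ 0 := right_ne_zero_of_mul (hF.u₂_eq ▸ hu₂)
  obtain ⟨c, hc, defect⟩ := hF.exists_defect_mul_eq hu₁ hu₃ heq
  have hcsxv₂ : c • s * x * v₂ ≠ 0 :=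
    left_ne_zero_of_mul (defect ▸ mul_ne_zero (mul_ne_zero hz hμ₂) hx)
  have hv₂s₂ : v₂ * s₂ ≠ 0 := mul_ne_zero (right_ne_zero_of_mul hcsxv₂) hs₂.ne_zero
  obtain ⟨Z, hZ⟩ := exists_isLongestWord hz
  obtain ⟨X, hX⟩ := exists_isLongestWord hx
  obtain ⟨M, hM⟩ := exists_isLongestWord hμ₂
  obtain ⟨V, hV⟩ := exists_isLongestWord (left_ne_zero_of_mul hv₂s₂)
  obtain ⟨T, hT⟩ := exists_isLongestWord (left_ne_zero_of_mul (hF.v₂_mul_eq ▸ hv₂s₂))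
  have defect_length := ((hZ.mul hM).mul hX).length_eq
    (defect ▸ ((((isLongestWord_smul_iff hc).2 hs).mul hX).mul hV).mul hZ)
  have v₂_length := (hV.mul hs₂).length_eq (hF.v₂_mul_eq ▸ hT.mul hM)
  simp only [FreeMonoid.length_mul] at defect_length v₂_length
  refine ht ((add_mem_cancel_right (one_mem _)).1 (mem_bot_iff.2 fun w hw => ?_))
  have := hT.2 w hw
  exact FreeMonoid.length_eq_zero.1 (by lia)

end IsFactorization

end Factorization

section Equation

variable {K α : Type*} [Field K] {u₁ u₂ u₃ v₁ v₂ v₃ s t₂ x : FreeAlgebra K α}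
  {U₁ U₂ U₃ V₁ V₂ V₃ X y β γ : FreeMonoid α}

/-- With `A := v₂ x t₂ - u₂ x`, the equation makes `A` right divisible by `x`, say `A = E x`, and
then `s x E = x u₂` makes `s x` left divisible by `x`. -/
lemma exists_of_reduced_solution (hx : IsTopWord x y) (hs : s ≠ 0) (hu₂ : u₂ ≠ 0) (hv₂ : v₂ ≠ 0)
    (heq : s * x * (v₂ * x * t₂ - u₂ * x) = x * u₂ * x) :
    ∃ t s₂ μ₂, s * x = x * t ∧ s₂ * x = x * t₂ ∧ u₂ = t * μ₂ ∧ v₂ * s₂ = (t + 1) * μ₂ := by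
  have hx0 := hx.ne_zero
  obtain ⟨E, hE⟩ := hx.exists_eq_mul_right_of_mul_eq_mul (mul_ne_zero hs hx0) heq
    ⟨specialize v₂ * specialize t₂ - specialize u₂, by
      simp only [map_sub, map_mul]
      ring⟩
  have hsE : s * x * E = x * u₂ := mul_right_cancel₀ hx0 (by rw [mul_assoc, ← hE, heq])
  have hE0 : E ≠ 0 := right_ne_zero_of_mul (hsE ▸ mul_ne_zero hx0 hu₂)
  obtain ⟨t, ht⟩ := hx.dvd_of_mul_eq_mul hE0 hsE (by rw [map_mul]; exact dvd_mul_left _ _)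
  have hu₂E : u₂ = t * E := mul_left_cancel₀ hx0 (by rw [← hsE, ht, mul_assoc])
  have hv₂E : v₂ * (x * t₂) = (u₂ + E) * x := by
    rw [add_mul, ← hE, mul_assoc, add_sub_cancel]
  obtain ⟨s₂, hs₂⟩ := hx.exists_eq_mul_right_of_mul_eq_mul hv₂ hv₂E
    (by rw [map_mul]; exact dvd_mul_right _ _)
  refine ⟨t, s₂, E, ht, hs₂.symm, hu₂E, mul_right_cancel₀ hx0 ?_⟩
  rw [mul_assoc, ← hs₂, hv₂E, hu₂E, add_mul t, one_mul]

lemma exists_eq_sub_mul_of_solution (hne : u₁ ≠ v₁) (hx : IsTopWord x y) (hβ : β ≠ 1)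
    (hy : β * y = y * γ) (hβsq : SquareFree β) (hu₁ : IsTopWord u₁ V₁) (hv₁ : IsTopWord v₁ V₁)
    (htop : wordCoeff V₁ u₁ = wordCoeff V₁ v₁) (hVsq : SquareFree V₁)
    (hl : V₁.length + β.length ≤ y.length) (hu₂ : u₂ ≠ 0) (hu₃ : u₃ ≠ 0)
    (heq : u₁ * x * u₂ * x * u₃ = v₁ * x * v₂ * x * v₃) :
    (∃ R, V₁ = R * β) ∧ ∃ s, v₁ = (u₁ - v₁) * s ∧ IsTopWord s β := by
  have hr : u₁ - v₁ ≠ 0 := sub_ne_zero.2 hne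
  have hD : u₂ * x * u₃ ≠ 0 := mul_ne_zero (mul_ne_zero hu₂ hx.ne_zero) hu₃
  have hCD : v₁ * (x * (v₂ * x * v₃ - u₂ * x * u₃)) = (u₁ - v₁) * (x * (u₂ * x * u₃)) := by
    simp only [mul_assoc] at heq
    simp only [mul_sub, sub_mul, mul_assoc, heq]
  have hC : v₂ * x * v₃ - u₂ * x * u₃ ≠ 0 :=
    right_ne_zero_of_mul (right_ne_zero_of_mul (hCD ▸ mul_ne_zero hr (mul_ne_zero hx.ne_zero hD)))
  obtain ⟨R, rfl, hR⟩ := exists_isTopWord_of_mul_eq_mul hv₁ hx hβ hβsq hy hVsq hl hr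
    (fun w hw => hu₁.length_lt_of_sub hv₁ htop hw) hD hCD
  rw [FreeMonoid.length_mul] at hl
  obtain ⟨s, hs⟩ := hR.dvd_of_squareFree hx hβ hy hVsq (by lia) hC hCD
  exact ⟨⟨R, rfl⟩, s, hs, .of_mul_left (hs ▸ hv₁) hR.1⟩

theorem exists_isFactorization (hne : u₁ ≠ v₁) (hu₁ : IsTopWord u₁ U₁) (hu₂ : IsTopWord u₂ U₂)
    (hu₃ : IsTopWord u₃ U₃) (hv₁ : IsTopWord v₁ V₁) (hv₂ : IsTopWord v₂ V₂)
    (hv₃ : IsTopWord v₃ V₃) (h₁ : U₁.length = V₁.length)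
    (htop : wordCoeff U₁ u₁ = wordCoeff V₁ v₁) (h₂ : V₂.length < U₂.length)
    (hU₂sq : SquareFree U₂) (hV₁sq : SquareFree V₁) (hV₃sq : SquareFree V₃)
    (hX : IsLongestWord x X) (hl₁₂ : U₁.length + U₂.length ≤ X.length)
    (hl₃ : U₃.length ≤ X.length) (heq : u₁ * x * u₂ * x * u₃ = v₁ * x * v₂ * x * v₃) :
    ∃ s t μ₁ μ₂ s₂ t₂, IsFactorization u₁ u₂ u₃ v₁ v₂ v₃ s t μ₁ μ₂ s₂ t₂ ∧
      ∀ x, s * x = x * t ↔ u₁ * x * u₂ * x * u₃ = v₁ * x * v₂ * x * v₃ := by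
  obtain ⟨y, β, γ, hx, hβ, hy, rfl, rfl, rfl⟩ :=
    exists_isTopWord_of_solution hu₁ hu₂ hu₃ hv₁ hv₂ hv₃ h₁ h₂ hX.ne_zero heq
  obtain rfl := hx.2 X hX
  have hγ : γ ≠ 1 := by
    rintro rfl
    exact hβ (by simpa using hy)
  have hβsq : SquareFree β := hU₂sq.of_mul_left
  rw [FreeMonoid.length_mul] at hl₁₂
  obtain ⟨⟨R, rfl⟩, s, hv₁_eq, hs⟩ := exists_eq_sub_mul_of_solution hne hx hβ hy hβsq hu₁ hv₁ htop
    hV₁sq (by lia) hu₂.ne_zero hu₃.ne_zero heq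
  obtain ⟨t₂, rfl⟩ := hu₃.exists_eq_mul_right_of_squareFree hx hγ hy hV₃sq hl₃
    (mul_ne_zero (mul_ne_zero hv₁.ne_zero hx.ne_zero) hv₂.ne_zero) heq.symm
  have reduced : s * x * (v₂ * x * t₂ - u₂ * x) = x * u₂ * x := by
    refine mul_right_cancel₀ hu₃.ne_zero (mul_left_cancel₀ (sub_ne_zero.2 hne) ?_)
    calc (u₁ - v₁) * (s * x * (v₂ * x * t₂ - u₂ * x) * u₃)
        = (u₁ - v₁) * s * x * v₂ * x * (t₂ * u₃) - (u₁ - v₁) * s * x * u₂ * x * u₃ := by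
          noncomm_ring
      _ = (u₁ - v₁) * (x * u₂ * x * u₃) := by
          rw [← hv₁_eq, ← heq]
          noncomm_ring
  obtain ⟨t, s₂, μ₂, hst, hst₂, hu₂_eq, hv₂_eq⟩ :=
    exists_of_reduced_solution hx hs.ne_zero hu₂.ne_zero hv₂.ne_zero reduced
  have ht : IsTopWord t γ := .of_mul_left (hy ▸ hst ▸ hs.mul hx) hx.1
  have ht₂ : IsTopWord t₂ γ := hv₃.of_mul_right hu₃.1
  have hs₂ : IsTopWord s₂ β := .of_mul_right (hy ▸ hst₂ ▸ hx.mul ht₂) hx.1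
  have ht_bot : t ∉ (⊥ : Subalgebra K (FreeAlgebra K α)) := fun h => hγ (mem_bot_iff.1 h γ ht.1.1)
  rw [FreeMonoid.length_mul] at hl₁₂
  have hF : IsFactorization u₁ u₂ u₃ v₁ v₂ (t₂ * u₃) s t (u₁ - v₁) μ₂ s₂ t₂ :=
    ⟨by rw [mul_add, ← hv₁_eq, mul_one, add_sub_cancel], hv₁_eq, hu₂_eq, hv₂_eq, rfl,
      exists_eq_smul_add_algebraMap hx hs hs₂ hβsq (by lia) hst hst₂⟩
  exact ⟨s, t, _, μ₂, s₂, t₂, hF, fun x => ⟨hF.solution_of_mul_eq_mul,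
    hF.mul_eq_mul_of_solution hs.1 hs₂.1 ht_bot hu₁.ne_zero hu₂.ne_zero hu₃.ne_zero⟩⟩

end Equation

section TopMonomials

variable {k : ℕ} {f : FA k} {m : FreeMonoid (Fin k)}

lemma mem_monomials : m ∈ monomials f ↔ wordCoeff m f ≠ 0 :=
  Finsupp.mem_support_iff

lemma wordCoeff_eq_one_of_ne_zero (h : wordCoeff m f ≠ 0) : wordCoeff m f = 1 :=
  Fin.eq_one_of_ne_zero _ h

lemma IsLongestWord.deg_eq (h : IsLongestWord f m) : deg f = m.length :=
  le_antisymm (Finset.sup_le fun w hw => h.2 w (mem_monomials.1 hw))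
    (Finset.le_sup (f := fun m : FreeMonoid (Fin k) => m.toList.length) (mem_monomials.2 h.1))

lemma IsTopMonomial.isTopWord (h : IsTopMonomial f m) : IsTopWord f m := by
  have length_lt : ∀ w, wordCoeff w f ≠ 0 → w ≠ m → w.length < m.length := fun w hw =>
    h.2 w (mem_monomials.2 hw)
  have hm := mem_monomials.1 h.1
  refine ⟨⟨hm, fun w hw => ?_⟩, fun w hw => ?_⟩
  · obtain rfl | hwm := eq_or_ne w m
    · exact le_rfl
    · exact (length_lt w hw hwm).le
  · by_contra hwm
    exact (length_lt w hw.1 hwm).not_ge (hw.2 m hm)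

lemma exists_isLongestWord_of_deg_pos (h : 0 < deg f) : ∃ m, IsLongestWord f m :=
  exists_isLongestWord fun h0 => by simp [h0, deg, monomials] at h

instance charP_two : CharP (FA k) 2 :=
  charP_of_injective_algebraMap FreeAlgebra.algebraMap_leftInverse.injective 2

lemma IsFactorization.eq_or_eq_add_one {u₁ u₂ u₃ v₁ v₂ v₃ s t μ₁ μ₂ s₂ t₂ : FA k}
    (hF : IsFactorization u₁ u₂ u₃ v₁ v₂ v₃ s t μ₁ μ₂ s₂ t₂) :
    (s₂ = s ∧ t₂ = t) ∨ (s₂ = s + 1 ∧ t₂ = t + 1) := by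
  obtain ⟨c, hc, d, rfl, rfl⟩ := hF.exists_eq_smul_add
  obtain rfl : c = 1 := Fin.eq_one_of_ne_zero c hc
  obtain rfl | hd := eq_or_ne d 0
  · simp
  · obtain rfl : d = 1 := Fin.eq_one_of_ne_zero d hd
    simp

end TopMonomials

end MonomialEq

open MonomialEq in
theorem lemma4p13_general {k : ℕ} (u₁ u₂ u₃ v₁ v₂ v₃ : FA k)
    (hne : u₁ ≠ v₁) (hdeg₁ : deg u₁ = deg v₁) (hdeg₂ : deg v₂ < deg u₂)
    (hu₁ : ∃ m, IsTopMonomial u₁ m) (hu₂ : AperiodicTop u₂) (hu₃ : ∃ m, IsTopMonomial u₃ m)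
    (hv₁ : AperiodicTop v₁) (hv₂ : ∃ m, IsTopMonomial v₂ m) (hv₃ : AperiodicTop v₃)
    (x₁ : FA k) (hx₁ : u₁ * x₁ * u₂ * x₁ * u₃ = v₁ * x₁ * v₂ * x₁ * v₃)
    (hlong₁₂ : deg u₁ + deg u₂ ≤ deg x₁) (hlong₃ : deg u₃ ≤ deg x₁) :
    ∃ s t : FA k,
      (∃ μ₁ μ₂ s₂ t₂ : FA k,
        u₁ = μ₁ * s ∧ v₁ = μ₁ * (s + 1) ∧ u₂ = (t + 1) * μ₂ ∧ v₂ * s₂ = t * μ₂ ∧ v₃ = t₂ * u₃ ∧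
          ((s₂ = s ∧ t₂ = t) ∨ (s₂ = s + 1 ∧ t₂ = t + 1))) ∧
      ∀ x : FA k, s * x = x * t ↔ u₁ * x * u₂ * x * u₃ = v₁ * x * v₂ * x * v₃ := by
  obtain ⟨U₁, hU₁⟩ := hu₁
  obtain ⟨U₂, hU₂, hsqU₂⟩ := hu₂
  obtain ⟨U₃, hU₃⟩ := hu₃
  obtain ⟨V₁, hV₁, hsqV₁⟩ := hv₁
  obtain ⟨V₂, hV₂⟩ := hv₂
  obtain ⟨V₃, hV₃, hsqV₃⟩ := hv₃
  obtain ⟨X, hX⟩ := exists_isLongestWord_of_deg_pos (show 0 < deg x₁ by lia)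
  replace hU₁ := hU₁.isTopWord
  replace hU₂ := hU₂.isTopWord
  replace hU₃ := hU₃.isTopWord
  replace hV₁ := hV₁.isTopWord
  replace hV₂ := hV₂.isTopWord
  rw [hU₁.1.deg_eq, hV₁.1.deg_eq] at hdeg₁
  rw [hV₂.1.deg_eq, hU₂.1.deg_eq] at hdeg₂
  rw [hU₁.1.deg_eq, hU₂.1.deg_eq, hX.deg_eq] at hlong₁₂
  rw [hU₃.1.deg_eq, hX.deg_eq] at hlong₃
  have htop : wordCoeff U₁ u₁ = wordCoeff V₁ v₁ :=
    (wordCoeff_eq_one_of_ne_zero hU₁.1.1).trans (wordCoeff_eq_one_of_ne_zero hV₁.1.1).symm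
  obtain ⟨s, t, μ₁, μ₂, s₂, t₂, hF, hiff⟩ := exists_isFactorization hne hU₁ hU₂ hU₃ hV₁ hV₂
    hV₃.isTopWord hdeg₁ htop hdeg₂ hsqU₂ hsqV₁ hsqV₃
    hX hlong₁₂ hlong₃ hx₁
  have add_one_add_one : ∀ f : FA k, f + 1 + 1 = f := fun f => CharTwo.add_cancel_right f 1
  refine ⟨s + 1, t + 1, ⟨μ₁, μ₂, s₂, t₂, hF.u₁_eq, ?_, ?_, hF.v₂_mul_eq, hF.v₃_eq, ?_⟩, ?_⟩
  · rw [add_one_add_one, hF.v₁_eq]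
  · rw [add_one_add_one, hF.u₂_eq]
  · rw [add_one_add_one, add_one_add_one]
    exact hF.eq_or_eq_add_one.symm
  · intro x
    rw [← hiff, add_mul, mul_add, one_mul, mul_one, add_left_inj]

theorem lemma4p13 {k : ℕ} (u₁ u₂ u₃ v₁ v₂ v₃ : MonomialEq.FA k)
    (hne : u₁ ≠ v₁)
    (hdeg₁ : MonomialEq.deg u₁ = MonomialEq.deg v₁)
    (hdeg₂ : MonomialEq.deg v₂ < MonomialEq.deg u₂)
    (hdeg₃ : MonomialEq.deg u₃ < MonomialEq.deg v₃)
    (hu₁ : MonomialEq.AperiodicTop u₁) (hu₂ : MonomialEq.AperiodicTop u₂)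
    (hu₃ : MonomialEq.AperiodicTop u₃) (hv₁ : MonomialEq.AperiodicTop v₁)
    (hv₂ : MonomialEq.AperiodicTop v₂) (hv₃ : MonomialEq.AperiodicTop v₃)
    (x₁ : MonomialEq.FA k)
    (hx₁ : u₁ * x₁ * u₂ * x₁ * u₃ = v₁ * x₁ * v₂ * x₁ * v₃)
    (hper : ∀ w y : FreeMonoid (Fin k),
      MonomialEq.IsTopMonomial (u₁ * x₁ * u₂ * x₁ * u₃) w → MonomialEq.IsTopMonomial x₁ y →
      MonomialEq.PeriodicityContainedIn w y)
    (hlong : 2 * (MonomialEq.deg u₁ + MonomialEq.deg u₂ + MonomialEq.deg u₃ ^ 2)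
      < MonomialEq.deg x₁) :
    ∃ s t : MonomialEq.FA k,
      ((∃ μ₁ μ₂ s₂ t₂ : MonomialEq.FA k,
          u₁ = μ₁ * (s + 1) ∧ v₁ = μ₁ * s ∧
          v₂ = (t + 1) * μ₂ ∧ u₂ = t * μ₂ * s₂ ∧ v₃ = t₂ * u₃ ∧
          ((s₂ = s ∧ t₂ = t) ∨ (s₂ = s + 1 ∧ t₂ = t + 1))) ∨
        (∃ μ₁ μ₂ s₂ t₂ : MonomialEq.FA k,
          u₁ = μ₁ * s ∧ v₁ = μ₁ * (s + 1) ∧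
          u₂ = (t + 1) * μ₂ ∧ v₂ * s₂ = t * μ₂ ∧ v₃ = t₂ * u₃ ∧
          ((s₂ = s ∧ t₂ = t) ∨ (s₂ = s + 1 ∧ t₂ = t + 1)))) ∧
      (∀ x : MonomialEq.FA k, s * x = x * t →
        u₁ * x * u₂ * x * u₃ = v₁ * x * v₂ * x * v₃) ∧
      (∀ x₂ : MonomialEq.FA k, u₁ * x₂ * u₂ * x₂ * u₃ = v₁ * x₂ * v₂ * x₂ * v₃ →
        2 * (2 + 2 ^ (MonomialEq.deg s + 2)
          + MonomialEq.deg u₁ + MonomialEq.deg u₂ + MonomialEq.deg u₃) < MonomialEq.deg x₂ →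
        s * x₂ = x₂ * t) := by
  have hdeg₃_sq := Nat.le_self_pow two_ne_zero (MonomialEq.deg u₃)
  obtain ⟨s, t, hB, hiff⟩ := lemma4p13_general u₁ u₂ u₃ v₁ v₂ v₃ hne hdeg₁ hdeg₂
    (hu₁.imp fun _ => And.left) hu₂ (hu₃.imp fun _ => And.left) hv₁ (hv₂.imp fun _ => And.left) hv₃
    x₁ hx₁ (by lia) (by lia)
  exact ⟨s, t, .inr hB, fun x => (hiff x).1, fun x hx _ => (hiff x).2 hx⟩
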